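/- Fix a finite label set $\Lambda$ with arities $\mathrm{ar}:\Lambda\to\mathbb N$. A graph is a finite hypergraph $G=(V_G,E_G,c_G,l_G)$ with $c_G:E_G\to V_G^*$, $l_G:E_G\to\Lambda$ and $|c_G(e)|=\mathrm{ar}(l_G(e))$. A morphism $\phi:G\rightharpoonup H$ is a pair of partial maps on nodes and edges such that whenever $\phi(e)$ is defined, $\phi$ is defined on all nodes of $c_G(e)$, $\phi(c_G(e))=c_H(\phi(e))$ and $l_G(e)=l_H(\phi(e))$. Pushouts are taken in the category of graphs and (partial) morphisms. A subgraph morphism is an injective and surjective (partial) morphism; $G\sqsubseteq H$ means that there is a subgraph morphism $H\rightharpoonup G$, and $\uparrow\mathcal S=\{H\mid \exists G\in\mathcal S:\ G\sqsubseteq H\}$. A universally quantified rule is a pair $\rho=(r,U)$ of a morphism $r:L\rightharpoonup R$ and a finite set $U$ of pairs $u=(p_u:L\to L_u,\ q_u:L_u\rightharpoonup R_u)$, where $p_u$ is total and injective, $q_u(p_u(x))$ is defined and has exactly one preimage under $q_u$ for every node or edge $x$ of $L$, and the set $\mathrm{qn}(u)$ of nodes $x$ of $L$ such that $p_u(x)$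 is incident to an edge of $L_u$ without preimage in $L$ is non-empty. Put $\mathrm{qn}(\rho)=\bigcup_{u\in U}\mathrm{qn}(u)$. Instantiations of $\rho$ are defined recursively: $(\mathrm{id}_L,r)$ is an instantiation of length $0$; if $(\pi:L\to\overline L,\ \gamma:\overline L\rightharpoonup\overline R)$ is an instantiation of length $k$ and $u\in U$, let $p_u':\overline L\to\overline L_u$, $\pi':L_u\to\overline L_u$ be the pushout of $\pi,p_u$, let $i:\overline R\rightharpoonup\overline R_u$, $j:R_u\rightharpoonup\overline R_u$ be the pushout of $\gamma\circ\pi,\ q_u\circ p_u$, and let $\eta:\overline L_u\rightharpoonup\overline R_u$ be the unique morphism with $\eta\circ p_u'=i\circ\gamma$ and $\eta\circ\pi'=j\circ q_u$; then $(p_u'\circ\pi,\eta)$ is an instantiation of length $k+1$. Let $b\in\mathbb N\cup\{\infty\}$. The backward application of an instantiation $\iota=(\pi,\gamma)$ to a graph $G$ computes all graphs $H$ obtained as follows: choose a subgraph morphism $\mu:\overline R\rightharpoonup R'$ and a total injective $m':R'\to G$; let $H$, with a total injective $m:\overline L\to H$, be a pushout complement of $\mu\circ\gamma$ and $m'$ (that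 is, $G$ with $m'$ and some $H\rightharpoonup G$ is a pushout of $\mu\circ\gamma$ and $m$) which is $\sqsubseteq$-minimal among the pushout complements of $\mu\circ\gamma$ and $m'$ with total injective match; keep $H$ if every edge of $H$ incident to $m(\pi(x))$ with $x\in\mathrm{qn}(\rho)$ has a preimage under $m$, and every undirected path of $H$ (without repeated nodes or edges) has length at most $b$ (no path restriction if $b=\infty$). **Proposition.** Let $\rho$ be a universally quantified rule, $G$ a graph and $b\in\mathbb N\cup\{\infty\}$. (1) If $\iota$ is an instantiation of $\rho$ of length $k>|V_G|+|E_G|$, then for every graph $H$ computed by the backward application of $\iota$ to $G$ there are an instantiation $\iota'$ of $\rho$ of length less than $k$ and a graph $H'$ computed by the backward application of $\iota'$ to $G$ with $H'\sqsubseteq H$. (2) Consequently the explicitly computable number $|V_G|+|E_G|$ bounds the length of the instantiations needed in a backward step: the graphs computed by the backward applications to $G$ of all instantiations of $\rho$ and those computed by the backward applications of the instantiations of length at most $|V_G|+|E_G|$ have the same upward closure with respect to $\sqsubseteq$. -/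

import Mathlib

namespace UGTS

open CategoryTheory

universe v u

/-- A finite hypergraph whose edges carry labels from `Λ`; an edge labelled `a` is attached to a
sequence of `ar a` nodes. -/
structure HGraph {Λ : Type v} (ar : Λ → ℕ) where
  /-- nodes -/
  V : Type u
  /-- edges -/
  E : Type u
  [fintypeV : Fintype V]
  [fintypeE : Fintype E]
  /-- the connection function -/
  conn : E → List V
  /-- the labelling function -/
  lab : E → Λ
  length_conn : ∀ e, (conn e).length = ar (lab e)

attribute [instance] HGraph.fintypeV HGraph.fintypeE

variable {Λ : Type v} {ar : Λ → ℕ}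

namespace HGraph

/-- The number of nodes plus the number of edges. -/
def size (G : HGraph.{v, u} ar) : ℕ := Fintype.card G.V + Fintype.card G.E

/-- A partial hypergraph morphism; `none` means "undefined". The equation in `conn_eq` says that
all nodes incident to `e` have an image and that the images form the sequence of `e'`. -/
@[ext]
structure Hom (G H : HGraph.{v, u} ar) where
  onV : G.V → Option H.V
  onE : G.E → Option H.E
  lab_eq : ∀ e e', onE e = some e' → G.lab e = H.lab e'
  conn_eq : ∀ e e', onE e = some e' → (G.conn e).map onV = (H.conn e').map some

/-- The category of finite hypergraphs and partial morphisms. -/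
instance : Category.{u} (HGraph.{v, u} ar) where
  Hom := Hom
  id G :=
    { onV := some
      onE := some
      lab_eq := by
        intro e e' h
        cases h
        rfl
      conn_eq := by
        intro e e' h
        cases h
        rfl }
  comp {A B C} f g :=
    { onV := fun x => (f.onV x).bind g.onV
      onE := fun x => (f.onE x).bind g.onE
      lab_eq := by
        intro e e'' h
        obtain ⟨e', h₁, h₂⟩ := Option.bind_eq_some_iff.1 h
        exact (f.lab_eq e e' h₁).trans (g.lab_eq e' e'' h₂)
      conn_eq := by
        intro e e'' h
        obtain ⟨e', h₁, h₂⟩ := Option.bind_eq_some_iff.1 h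
        have hf := congrArg (List.map fun o : Option B.V => o.bind g.onV) (f.conn_eq e e' h₁)
        rw [List.map_map, List.map_map] at hf
        exact hf.trans (g.conn_eq e' e'' h₂) }
  id_comp f := rfl
  comp_id f := by
    apply Hom.ext
    · funext x
      exact Option.bind_fun_some _
    · funext x
      exact Option.bind_fun_some _
  assoc f g h := by
    apply Hom.ext
    · funext x
      exact Option.bind_assoc _ _ _
    · funext x
      exact Option.bind_assoc _ _ _

end HGraph

variable {G H K : HGraph.{v, u} ar}

/-- The partial map on nodes. -/
def onV (f : G ⟶ H) : G.V → Option H.V := HGraph.Hom.onV f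

/-- The partial map on edges. -/
def onE (f : G ⟶ H) : G.E → Option H.E := HGraph.Hom.onE f

/-- The morphism is defined on all nodes and edges. -/
def Total (f : G ⟶ H) : Prop :=
  (∀ x, ∃ y, onV f x = some y) ∧ (∀ x, ∃ y, onE f x = some y)

/-- Two different nodes (edges) on which the morphism is defined have different images. -/
def Inj (f : G ⟶ H) : Prop :=
  (∀ x x' y, onV f x = some y → onV f x' = some y → x = x') ∧
  (∀ x x' y, onE f x = some y → onE f x' = some y → x = x')

/-- Every node and every edge of the target is an image. -/
def Surj (f : G ⟶ H) : Prop :=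
  (∀ y, ∃ x, onV f x = some y) ∧ (∀ y, ∃ x, onE f x = some y)

/-- Subgraph morphisms: partial, injective and surjective. -/
def IsSubgraphMor (μ : G ⟶ H) : Prop := Inj μ ∧ Surj μ

/-- The subgraph order: `G` is a subgraph of `H`. -/
def IsSubgraph (G H : HGraph.{v, u} ar) : Prop := ∃ μ : H ⟶ G, IsSubgraphMor μ

/-- The upward closure with respect to the subgraph order. -/
def upClosure (S : Set (HGraph.{v, u} ar)) : Set (HGraph.{v, u} ar) :=
  {H | ∃ G ∈ S, IsSubgraph G H}

/-- `v₀, e₁, v₁, …, eₙ, vₙ` is an undirected path of length `n`, without repeated nodes or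
edges. -/
def IsUPath (G : HGraph.{v, u} ar) (n : ℕ) (vs : Fin (n + 1) → G.V) (es : Fin n → G.E) : Prop :=
  Function.Injective vs ∧ Function.Injective es ∧
    ∀ i : Fin n, vs i.castSucc ∈ G.conn (es i) ∧ vs i.succ ∈ G.conn (es i)

/-- Every undirected path has length at most `b`; for `b = ⊤` there is no restriction. -/
def PathBounded (b : ℕ∞) (G : HGraph.{v, u} ar) : Prop :=
  ∀ (n : ℕ) (vs : Fin (n + 1) → G.V) (es : Fin n → G.E), IsUPath G n vs es → (n : ℕ∞) ≤ b

/-- The nodes `x` of `L` such that some edge incident to `p x` has no preimage in `L`. -/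
def newEdgeNodes {L Lu : HGraph.{v, u} ar} (p : L ⟶ Lu) : Set L.V :=
  {x | ∃ y e, onV p x = some y ∧ y ∈ Lu.conn e ∧ ∀ e₀, onE p e₀ ≠ some e}

/-- A universal quantification over the left-hand side `L`. -/
structure UQuant (L : HGraph.{v, u} ar) where
  Lu : HGraph.{v, u} ar
  Ru : HGraph.{v, u} ar
  p : L ⟶ Lu
  q : Lu ⟶ Ru
  p_total : Total p
  p_inj : Inj p
  /-- `q (p x)` is defined and has exactly one preimage under `q`, for every node `x` of `L` -/
  q_node : ∀ x, ∃ y, onV (p ≫ q) x = some y ∧ ∃! z, onV q z = some y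
  /-- `q (p x)` is defined and has exactly one preimage under `q`, for every edge `x` of `L` -/
  q_edge : ∀ x, ∃ y, onE (p ≫ q) x = some y ∧ ∃! z, onE q z = some y
  qNodes_nonempty : (newEdgeNodes p).Nonempty

/-- The quantified nodes of a universal quantification. -/
def UQuant.qNodes {L : HGraph.{v, u} ar} (w : UQuant L) : Set L.V := newEdgeNodes w.p

/-- A universally quantified rule. -/
structure UQRule {Λ : Type v} (ar : Λ → ℕ) where
  L : HGraph.{v, u} ar
  R : HGraph.{v, u} ar
  r : L ⟶ R
  U : Set (UQuant L)
  finite_U : U.Finite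

/-- The quantified nodes of a rule. -/
def UQRule.qNodes (ρ : UQRule.{v, u} ar) : Set ρ.L.V := {x | ∃ w ∈ ρ.U, x ∈ w.qNodes}

/-- The data of an instantiation: a pair of morphisms `π : L ⟶ Lbar` and `γ : Lbar ⟶ Rbar`. -/
structure InstData (ρ : UQRule.{v, u} ar) where
  Lbar : HGraph.{v, u} ar
  Rbar : HGraph.{v, u} ar
  π : ρ.L ⟶ Lbar
  γ : Lbar ⟶ Rbar

/-- `IsInstantiation ρ k ι`: the pair `ι` is an instantiation of `ρ` of length `k`. Pushouts are
taken in the category of partial morphisms and may be represented by any pushout object; `η` is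
the mediating morphism out of `Lbar'`. -/
inductive IsInstantiation (ρ : UQRule.{v, u} ar) : ℕ → InstData ρ → Prop
  | base : IsInstantiation ρ 0 ⟨ρ.L, ρ.R, 𝟙 ρ.L, ρ.r⟩
  | step {k : ℕ} {ι : InstData ρ} (hι : IsInstantiation ρ k ι)
      {w : UQuant ρ.L} (hw : w ∈ ρ.U) {Lbar' Rbar' : HGraph.{v, u} ar}
      {p' : ι.Lbar ⟶ Lbar'} {π' : w.Lu ⟶ Lbar'} (hL : IsPushout ι.π w.p p' π')
      {i : ι.Rbar ⟶ Rbar'} {j : w.Ru ⟶ Rbar'} (hR : IsPushout (ι.π ≫ ι.γ) (w.p ≫ w.q) i j)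
      {η : Lbar' ⟶ Rbar'} (h₁ : p' ≫ η = ι.γ ≫ i) (h₂ : π' ≫ η = w.q ≫ j) :
      IsInstantiation ρ (k + 1) ⟨Lbar', Rbar', ι.π ≫ p', η⟩

/-- `H` with `m : L ⟶ H` is a pushout complement of `φ : L ⟶ R` and the co-match `m' : R ⟶ G`,
and `m` is total and injective. -/
def IsComplement {L R G : HGraph.{v, u} ar} (φ : L ⟶ R) (m' : R ⟶ G)
    (H : HGraph.{v, u} ar) (m : L ⟶ H) : Prop :=
  Total m ∧ Inj m ∧ ∃ φ' : H ⟶ G, IsPushout φ m m' φ'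

/-- A pushout complement (with injective match) that is minimal in the subgraph order. -/
def IsMinComplement {L R G : HGraph.{v, u} ar} (φ : L ⟶ R) (m' : R ⟶ G)
    (H : HGraph.{v, u} ar) (m : L ⟶ H) : Prop :=
  IsComplement φ m' H m ∧
    ∀ (H₀ : HGraph.{v, u} ar) (m₀ : L ⟶ H₀), IsComplement φ m' H₀ m₀ →
      IsSubgraph H₀ H → IsSubgraph H H₀

/-- The application condition: every edge incident to the image of a quantified node of the rule
is in the image of the match. -/
def AppCondition {ρ : UQRule.{v, u} ar} (ι : InstData ρ) {H : HGraph.{v, u} ar}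
    (m : ι.Lbar ⟶ H) : Prop :=
  ∀ x ∈ ρ.qNodes, ∀ y, onV (ι.π ≫ m) x = some y →
    ∀ e, y ∈ H.conn e → ∃ e₀, onE m e₀ = some e

/-- The graphs computed by the backward application of `ι` to `G` (with path bound `b`). -/
def backward (b : ℕ∞) {ρ : UQRule.{v, u} ar} (ι : InstData ρ) (G : HGraph.{v, u} ar) :
    Set (HGraph.{v, u} ar) :=
  {H | ∃ (R' : HGraph.{v, u} ar) (μ : ι.Rbar ⟶ R') (m' : R' ⟶ G) (m : ι.Lbar ⟶ H),
    IsSubgraphMor μ ∧ Total m' ∧ Inj m' ∧ IsMinComplement (ι.γ ≫ μ) m' H m ∧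
      AppCondition ι m ∧ PathBounded b H}

/-- The graphs computed by backward applications of all instantiations of `ρ`. -/
def backwardAll (b : ℕ∞) (ρ : UQRule.{v, u} ar) (G : HGraph.{v, u} ar) :
    Set (HGraph.{v, u} ar) :=
  {H | ∃ k ι, IsInstantiation ρ k ι ∧ H ∈ backward b ι G}

/-- The graphs computed by backward applications of the instantiations of length at most `N`. -/
def backwardUpTo (N : ℕ) (b : ℕ∞) (ρ : UQRule.{v, u} ar) (G : HGraph.{v, u} ar) :
    Set (HGraph.{v, u} ar) :=
  {H | ∃ k ι, k ≤ N ∧ IsInstantiation ρ k ι ∧ H ∈ backward b ι G}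

end UGTS

/-! Compose the chosen subgraph morphism with the co-match to get an injective partial morphism `ν`
from the right-hand side of the instantiation to `G`. Each step glues new nodes and edges to the
right-hand side. If `ν` is defined on something new at every step, injectivity makes the image of
`ν` grow each time, so the length is at most `G.size`. Hence in a longer instantiation some step is
vacant: `ν` is undefined on everything it adds. Steps commute (`StepData.exchange`), so the vacant
step can be moved to the end (`IsInstantiation.exists_vacant`).

A vacant last step can be omitted (`StepData.Vacant.exists_backward`). Deleting what it adds to the
left-hand side is a subgraph morphism `d`, and the old rule morphism factors through `d` after
composition with `μ` (`StepData.Vacant.retraction_comp`). Pushing the match out along `d` gives a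
subgraph `H'` of `H`, and pushout decomposition makes `H'` a pushout complement for the shorter
instantiation. Minimality carries over because it means that every edge outside the match survives
into `G`. The second claim follows by iterating.

All of this rests on an explicit pushout of a partial morphism along a total injective one
(`isPushout_glue`), read off set by set through `IsAmalgam`. -/

namespace UGTS

open CategoryTheory

universe v u

variable {Λ : Type v} {ar : Λ → ℕ}

/-! ### Partial morphisms: composition, incidence, split morphisms -/

section Basic

variable {A B C : HGraph.{v, u} ar}

theorem hom_ext {f g : A ⟶ B} (hV : ∀ x, onV f x = onV g x) (hE : ∀ x, onE f x = onE g x) :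
    f = g :=
  HGraph.Hom.ext (funext hV) (funext hE)

@[simp]
theorem onV_id (x : A.V) : onV (𝟙 A) x = some x := rfl

@[simp]
theorem onE_id (x : A.E) : onE (𝟙 A) x = some x := rfl

@[simp]
theorem onV_comp (f : A ⟶ B) (g : B ⟶ C) (x : A.V) : onV (f ≫ g) x = (onV f x).bind (onV g) :=
  rfl

@[simp]
theorem onE_comp (f : A ⟶ B) (g : B ⟶ C) (x : A.E) : onE (f ≫ g) x = (onE f x).bind (onE g) :=
  rfl

theorem onV_comp_eq_some {f : A ⟶ B} {g : B ⟶ C} {x : A.V} {z : C.V} :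
    onV (f ≫ g) x = some z ↔ ∃ y, onV f x = some y ∧ onV g y = some z :=
  Option.bind_eq_some_iff

theorem onE_comp_eq_some {f : A ⟶ B} {g : B ⟶ C} {x : A.E} {z : C.E} :
    onE (f ≫ g) x = some z ↔ ∃ y, onE f x = some y ∧ onE g y = some z :=
  Option.bind_eq_some_iff

theorem conn_map (f : A ⟶ B) {e : A.E} {e' : B.E} (h : onE f e = some e') :
    (A.conn e).map (onV f) = (B.conn e').map some :=
  HGraph.Hom.conn_eq f e e' h

theorem lab_map (f : A ⟶ B) {e : A.E} {e' : B.E} (h : onE f e = some e') :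
    A.lab e = B.lab e' :=
  HGraph.Hom.lab_eq f e e' h

theorem exists_mem_conn_of_onE (f : A ⟶ B) {e : A.E} {e' : B.E} (h : onE f e = some e')
    {x : A.V} (hx : x ∈ A.conn e) : ∃ y ∈ B.conn e', onV f x = some y := by
  have h₁ : onV f x ∈ (A.conn e).map (onV f) := List.mem_map_of_mem hx
  rw [conn_map f h, List.mem_map] at h₁
  obtain ⟨y, hy, h₂⟩ := h₁
  exact ⟨y, hy, h₂.symm⟩

theorem exists_mem_conn_lift (f : A ⟶ B) {e : A.E} {e' : B.E} (h : onE f e = some e')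
    {y : B.V} (hy : y ∈ B.conn e') : ∃ x ∈ A.conn e, onV f x = some y := by
  have h₁ : some y ∈ (B.conn e').map some := List.mem_map_of_mem hy
  rwa [← conn_map f h, List.mem_map] at h₁

theorem Inj.comp {f : A ⟶ B} {g : B ⟶ C} (hf : Inj f) (hg : Inj g) : Inj (f ≫ g) := by
  constructor
  · intro x x' z h h'
    obtain ⟨y, hy, hz⟩ := Option.bind_eq_some_iff.1 h
    obtain ⟨y', hy', hz'⟩ := Option.bind_eq_some_iff.1 h'
    obtain rfl := hg.1 _ _ _ hz hz'
    exact hf.1 _ _ _ hy hy'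
  · intro x x' z h h'
    obtain ⟨y, hy, hz⟩ := Option.bind_eq_some_iff.1 h
    obtain ⟨y', hy', hz'⟩ := Option.bind_eq_some_iff.1 h'
    obtain rfl := hg.2 _ _ _ hz hz'
    exact hf.2 _ _ _ hy hy'

theorem Surj.comp {f : A ⟶ B} {g : B ⟶ C} (hf : Surj f) (hg : Surj g) : Surj (f ≫ g) := by
  constructor
  · intro z
    obtain ⟨y, hy⟩ := hg.1 z
    obtain ⟨x, hx⟩ := hf.1 y
    exact ⟨x, by simp [hy, hx]⟩
  · intro z
    obtain ⟨y, hy⟩ := hg.2 z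
    obtain ⟨x, hx⟩ := hf.2 y
    exact ⟨x, by simp [hy, hx]⟩

theorem IsSubgraph.trans {A B C : HGraph.{v, u} ar} (h₁ : IsSubgraph A B) (h₂ : IsSubgraph B C) :
    IsSubgraph A C := by
  obtain ⟨f, hf⟩ := h₁
  obtain ⟨g, hg⟩ := h₂
  exact ⟨g ≫ f, hg.1.comp hf.1, hg.2.comp hf.2⟩

theorem Surj.epi {f : A ⟶ B} (hf : Surj f) : Epi f where
  left_cancellation g h hgh := by
    apply hom_ext
    · intro y
      obtain ⟨x, hx⟩ := hf.1 y
      have := congrArg (fun k => onV k x) hgh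
      simpa [hx] using this
    · intro y
      obtain ⟨x, hx⟩ := hf.2 y
      have := congrArg (fun k => onE k x) hgh
      simpa [hx] using this

theorem surj_of_comp_eq_id {f : A ⟶ B} {g : B ⟶ A} (h : f ≫ g = 𝟙 A) : Surj g := by
  constructor
  · intro x
    have := congrArg (fun k => onV k x) h
    obtain ⟨y, -, hy⟩ := Option.bind_eq_some_iff.1 this
    exact ⟨y, hy⟩
  · intro x
    have := congrArg (fun k => onE k x) h
    obtain ⟨y, -, hy⟩ := Option.bind_eq_some_iff.1 this
    exact ⟨y, hy⟩

theorem total_of_comp_eq_id {f : A ⟶ B} {g : B ⟶ A} (h : f ≫ g = 𝟙 A) : Total f := by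
  constructor
  · intro x
    have := congrArg (fun k => onV k x) h
    obtain ⟨y, hy, -⟩ := Option.bind_eq_some_iff.1 this
    exact ⟨y, hy⟩
  · intro x
    have := congrArg (fun k => onE k x) h
    obtain ⟨y, hy, -⟩ := Option.bind_eq_some_iff.1 this
    exact ⟨y, hy⟩

theorem inj_of_comp_eq_id {f : A ⟶ B} {g : B ⟶ A} (h : f ≫ g = 𝟙 A) : Inj f := by
  constructor
  · intro x x' y hx hx'
    have h₁ := congrArg (fun k => onV k x) h
    have h₂ := congrArg (fun k => onV k x') h
    simp only [onV_comp, hx, hx', onV_id, Option.bind_some] at h₁ h₂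
    exact Option.some.inj (h₁.symm.trans h₂)
  · intro x x' y hx hx'
    have h₁ := congrArg (fun k => onE k x) h
    have h₂ := congrArg (fun k => onE k x') h
    simp only [onE_comp, hx, hx', onE_id, Option.bind_some] at h₁ h₂
    exact Option.some.inj (h₁.symm.trans h₂)

end Basic

/-! ### Amalgams of sets along a total injection -/

/-- The set-level description of a pushout of a partial map `f` along a total injection `g`: the
map `i` is a total injection, `i` and `j` are jointly surjective, `j` is injective outside the
range of `g` and sends nothing outside that range into the range of `i`. -/
structure IsAmalgam {A B C D : Type u} (g : A → Option C) (i : B → Option D)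
    (j : C → Option D) : Prop where
  total : ∀ b, ∃ d, i b = some d
  inj : ∀ b b' d, i b = some d → i b' = some d → b = b'
  surj : ∀ d, (∃ b, i b = some d) ∨ ∃ c, j c = some d
  inj_compl : ∀ c c' d, (∀ a, g a ≠ some c) → (∀ a, g a ≠ some c') →
    j c = some d → j c' = some d → c = c'
  overlap : ∀ b c d, i b = some d → j c = some d → ∃ a, g a = some c

/-- Carries the description from the explicit glued graph to an arbitrary pushout object, along the
comparison isomorphism. -/
theorem IsAmalgam.bind {A B C D D' : Type u} {g : A → Option C} {i : B → Option D}
    {j : C → Option D} (h : IsAmalgam g i j) {t : D → Option D'}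
    (total : ∀ d, ∃ d', t d = some d') (inj : ∀ d₁ d₂ d', t d₁ = some d' → t d₂ = some d' → d₁ = d₂)
    (surj : ∀ d', ∃ d, t d = some d') :
    IsAmalgam g (fun b => (i b).bind t) (fun c => (j c).bind t) where
  total b := by
    obtain ⟨d, hd⟩ := h.total b
    obtain ⟨d', hd'⟩ := total d
    exact ⟨d', by simp [hd, hd']⟩
  inj b b' d' hb hb' := by
    obtain ⟨d₁, h₁, h₁'⟩ := Option.bind_eq_some_iff.1 hb
    obtain ⟨d₂, h₂, h₂'⟩ := Option.bind_eq_some_iff.1 hb'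
    obtain rfl := inj _ _ _ h₁' h₂'
    exact h.inj _ _ _ h₁ h₂
  surj d' := by
    obtain ⟨d, hd⟩ := surj d'
    rcases h.surj d with ⟨b, hb⟩ | ⟨c, hc⟩
    · exact Or.inl ⟨b, by simp [hb, hd]⟩
    · exact Or.inr ⟨c, by simp [hc, hd]⟩
  inj_compl c c' d' hc hc' hb hb' := by
    obtain ⟨d₁, h₁, h₁'⟩ := Option.bind_eq_some_iff.1 hb
    obtain ⟨d₂, h₂, h₂'⟩ := Option.bind_eq_some_iff.1 hb'
    obtain rfl := inj _ _ _ h₁' h₂'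
    exact h.inj_compl _ _ _ hc hc' h₁ h₂
  overlap b c d' hb hc := by
    obtain ⟨d₁, h₁, h₁'⟩ := Option.bind_eq_some_iff.1 hb
    obtain ⟨d₂, h₂, h₂'⟩ := Option.bind_eq_some_iff.1 hc
    obtain rfl := inj _ _ _ h₁' h₂'
    exact h.overlap _ _ _ h₁ h₂

section Amalgam

variable {A B C X : Type u} {f : A → Option B} {g : A → Option C} {P : C → Prop}

open Classical in
/-- The map from `C` into the amalgam of `B` and `C` over `A`, where an element outside the range
of `g` survives only if it satisfies `P`. -/
noncomputable def amalgMap (f : A → Option B) (g : A → Option C) (P : C → Prop) (c : C) :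
    Option (B ⊕ {c : C // (∀ a, g a ≠ some c) ∧ P c}) :=
  if h : ∃ a, g a = some c then (f h.choose).map Sum.inl
  else if hP : P c then some (Sum.inr ⟨c, fun a ha => h ⟨a, ha⟩, hP⟩) else none

theorem amalgMap_of_eq (g_inj : ∀ a a' c, g a = some c → g a' = some c → a = a') {a : A} {c : C}
    (h : g a = some c) : amalgMap f g P c = (f a).map Sum.inl := by
  have h' : ∃ a, g a = some c := ⟨a, h⟩
  rw [amalgMap, dif_pos h', g_inj _ _ _ h'.choose_spec h]

theorem amalgMap_of_pos {c : C} (h : ∀ a, g a ≠ some c) (hP : P c) :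
    amalgMap f g P c = some (Sum.inr ⟨c, h, hP⟩) := by
  rw [amalgMap, dif_neg (fun ⟨a, ha⟩ => h a ha), dif_pos hP]

theorem amalgMap_of_neg {c : C} (h : ∀ a, g a ≠ some c) (hP : ¬ P c) :
    amalgMap f g P c = none := by
  rw [amalgMap, dif_neg (fun ⟨a, ha⟩ => h a ha), dif_neg hP]

/-- Discarding elements of `C` by `P` does no harm, since an amalgam does not require `j` to be
total. -/
theorem isAmalgam_amalgMap : IsAmalgam g (fun b => some (Sum.inl b)) (amalgMap f g P) where
  total b := ⟨_, rfl⟩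
  inj b b' d h h' := Sum.inl_injective (Option.some.inj (h.trans h'.symm))
  surj d := by
    rcases d with b | ⟨c, hc, hP⟩
    · exact Or.inl ⟨b, rfl⟩
    · exact Or.inr ⟨c, amalgMap_of_pos hc hP⟩
  inj_compl c c' d hc hc' h h' := by
    by_cases hP : P c
    · by_cases hP' : P c'
      · rw [amalgMap_of_pos hc hP] at h
        rw [amalgMap_of_pos hc' hP'] at h'
        have := h.trans h'.symm
        simpa using this
      · simp [amalgMap_of_neg hc' hP'] at h'
    · simp [amalgMap_of_neg hc hP] at h
  overlap b c d hb hc := by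
    by_contra! h
    by_cases hP : P c
    · rw [amalgMap_of_pos h hP, ← hb] at hc
      simp at hc
    · simp [amalgMap_of_neg h hP] at hc

/-- The universal property at set level. Any `t` of a cocone factors, provided it is already
undefined on the discarded elements. -/
theorem amalgMap_bind (g_inj : ∀ a a' c, g a = some c → g a' = some c → a = a')
    {s : B → Option X} {t : C → Option X} (hst : ∀ a, (f a).bind s = (g a).bind t)
    (ht : ∀ c, (∀ a, g a ≠ some c) → ¬ P c → t c = none) (c : C) :
    (amalgMap f g P c).bind (Sum.elim s fun c => t c.1) = t c := by
  by_cases h : ∃ a, g a = some c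
  · obtain ⟨a, ha⟩ := h
    have := hst a
    rw [ha, Option.bind_some] at this
    rw [amalgMap_of_eq g_inj ha, ← this]
    cases f a <;> rfl
  · push Not at h
    by_cases hP : P c
    · rw [amalgMap_of_pos h hP]
      rfl
    · rw [amalgMap_of_neg h hP, ht c h hP]
      rfl

end Amalgam

/-! ### Explicit pushouts of graphs along total injective morphisms -/

theorem map_some_filterMap {α β : Type*} (f : α → Option β) :
    ∀ l : List α, (∀ x ∈ l, f x ≠ none) → (l.filterMap f).map some = l.map f
  | [], _ => rfl
  | a :: l, h => by
    obtain ⟨b, hb⟩ := Option.ne_none_iff_exists'.1 (h a (by simp))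
    have ih := map_some_filterMap f l fun x hx => h x (by simp [hx])
    simp [hb, ih]

section Glue

variable {A B C : HGraph.{v, u} ar} (f : A ⟶ B) (g : A ⟶ C)

/-- The action on nodes of the map from `C` into the graph glued from `B` and `C` over `A`. -/
noncomputable def glueNode : C.V → Option (B.V ⊕ {c : C.V // (∀ a, onV g a ≠ some c) ∧ True}) :=
  amalgMap (onV f) (onV g) fun _ => True

theorem glueNode_of_notMem_range {c : C.V} (hc : ∀ a, onV g a ≠ some c) :
    glueNode f g c = some (Sum.inr ⟨c, hc, trivial⟩) :=
  amalgMap_of_pos (P := fun _ => True) hc trivial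

/-- All nodes of the edge `e` of `C` survive in the graph glued from `B` and `C` over `A`. -/
def Survives (e : C.E) : Prop := ∀ x ∈ C.conn e, glueNode f g x ≠ none

open Classical in
/-- The graph glued from `B` and `C` over `A`, for `g` total and injective: the disjoint union of
`B` and of the part of `C` outside the range of `g`, without the dangling edges. -/
noncomputable def glue : HGraph.{v, u} ar where
  V := B.V ⊕ {c : C.V // (∀ a, onV g a ≠ some c) ∧ True}
  E := B.E ⊕ {c : C.E // (∀ a, onE g a ≠ some c) ∧ Survives f g c}
  conn := Sum.elim (fun e => (B.conn e).map Sum.inl)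
    (fun e => (C.conn e.1).filterMap (glueNode f g))
  lab := Sum.elim B.lab (fun e => C.lab e.1)
  length_conn := by
    rintro (e | e)
    · simp [B.length_conn]
    · have := congrArg List.length (map_some_filterMap (glueNode f g) _ e.2.2)
      simp only [List.length_map] at this
      simp [this, C.length_conn]

/-- The inclusion of `B` into the glued graph. -/
noncomputable def glueInl : B ⟶ glue f g :=
  HGraph.Hom.mk (fun x => some (Sum.inl x)) (fun x => some (Sum.inl x))
    (by rintro e e' h; cases h; rfl)
    (by rintro e e' h; cases h; simp [glue])

variable {f g} in
theorem map_glueNode_conn (hg : Inj g) {a : A.E} {b : B.E} {c : C.E} (hb : onE f a = some b)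
    (hc : onE g a = some c) :
    (C.conn c).map (glueNode f g) = ((B.conn b).map Sum.inl).map some := by
  have h₁ := congrArg (List.map fun o : Option C.V => o.bind (glueNode f g)) (conn_map g hc)
  have h₂ := congrArg (List.map fun o : Option B.V => o.map
    (Sum.inl : B.V → B.V ⊕ {c : C.V // (∀ a, onV g a ≠ some c) ∧ True})) (conn_map f hb)
  simp only [List.map_map] at h₁ h₂ ⊢
  refine Eq.trans h₁.symm (Eq.trans ?_ h₂)
  apply List.map_congr_left
  intro x hx
  obtain ⟨y, -, hy⟩ := exists_mem_conn_of_onE g hc hx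
  simp only [Function.comp_apply, hy, Option.bind_some]
  exact amalgMap_of_eq hg.1 hy

/-- The partial map from `C` into the glued graph. -/
noncomputable def glueInr (hg : Inj g) : C ⟶ glue f g :=
  HGraph.Hom.mk (glueNode f g) (amalgMap (onE f) (onE g) (Survives f g))
    (by
      intro c e h
      by_cases hc : ∃ a, onE g a = some c
      · obtain ⟨a, ha⟩ := hc
        rw [amalgMap_of_eq hg.2 ha] at h
        obtain ⟨b, hb, rfl⟩ := Option.map_eq_some_iff.1 h
        exact (lab_map g ha).symm.trans (lab_map f hb)
      · push Not at hc
        by_cases hP : Survives f g c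
        · rw [amalgMap_of_pos hc hP] at h
          cases h
          rfl
        · simp [amalgMap_of_neg hc hP] at h)
    (by
      intro c e h
      by_cases hc : ∃ a, onE g a = some c
      · obtain ⟨a, ha⟩ := hc
        rw [amalgMap_of_eq hg.2 ha] at h
        obtain ⟨b, hb, rfl⟩ := Option.map_eq_some_iff.1 h
        exact map_glueNode_conn hg hb ha
      · push Not at hc
        by_cases hP : Survives f g c
        · rw [amalgMap_of_pos hc hP] at h
          cases h
          exact (map_some_filterMap _ _ hP).symm
        · simp [amalgMap_of_neg hc hP] at h)

theorem glue_comm (hg : Total g) (hg' : Inj g) : f ≫ glueInl f g = g ≫ glueInr f g hg' := by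
  apply hom_ext
  · intro a
    obtain ⟨c, hc⟩ := hg.1 a
    rw [onV_comp, onV_comp, hc, Option.bind_some]
    refine Eq.trans ?_ (amalgMap_of_eq hg'.1 hc).symm
    cases onV f a <;> rfl
  · intro a
    obtain ⟨c, hc⟩ := hg.2 a
    rw [onE_comp, onE_comp, hc, Option.bind_some]
    refine Eq.trans ?_ (amalgMap_of_eq hg'.2 hc).symm
    cases onE f a <;> rfl

section Desc

variable {f g} {X : HGraph.{v, u} ar} {s : B ⟶ X} {t : C ⟶ X}

theorem glueNode_bind (hg : Inj g) (hst : f ≫ s = g ≫ t) (c : C.V) :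
    (glueNode f g c).bind (Sum.elim (onV s) fun c => onV t c.1) = onV t c :=
  amalgMap_bind hg.1 (fun a => congrArg (fun k => onV k a) hst) (by simp) c

/-- A node lost in the gluing is undefined under every cocone, so its incident edges must be
undefined too. This is why removing dangling edges is compatible with the universal property. -/
theorem onE_eq_none_of_not_survives (hg : Inj g) (hst : f ≫ s = g ≫ t) {c : C.E}
    (hc : ¬ Survives f g c) : onE t c = none := by
  rw [Survives] at hc
  push Not at hc
  obtain ⟨x, hx, hn⟩ := hc
  by_contra h
  obtain ⟨e, he⟩ := Option.ne_none_iff_exists'.1 h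
  obtain ⟨y, -, hy⟩ := exists_mem_conn_of_onE t he hx
  have := glueNode_bind hg hst x
  rw [hn, hy] at this
  cases this

/-- The mediating morphism out of the glued graph. -/
noncomputable def glueDesc (hg : Inj g) (hst : f ≫ s = g ≫ t) : glue f g ⟶ X :=
  HGraph.Hom.mk (Sum.elim (onV s) fun c => onV t c.1) (Sum.elim (onE s) fun c => onE t c.1)
    (by
      rintro (b | c) x h
      · exact lab_map s h
      · exact lab_map t h)
    (by
      rintro (b | c) x h
      · refine Eq.trans ?_ (conn_map s h)
        simp [glue]
      · refine Eq.trans ?_ (conn_map t h)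
        have h₁ := congrArg (List.map fun o => o.bind (Sum.elim (onV s) fun c => onV t c.1))
          (map_some_filterMap (glueNode f g) _ c.2.2)
        simp only [List.map_map] at h₁
        refine Eq.trans h₁ (List.map_congr_left fun x _ => glueNode_bind hg hst x))

end Desc

variable {f g}

theorem isPushout_glue (hg : Total g) (hg' : Inj g) :
    IsPushout f g (glueInl f g) (glueInr f g hg') :=
  IsPushout.of_isColimit' ⟨glue_comm f g hg hg'⟩ <|
    Limits.PushoutCocone.IsColimit.mk _
      (fun s => glueDesc hg' s.condition)
      (fun s => rfl)
      (fun s => hom_ext (glueNode_bind hg' s.condition)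
        (amalgMap_bind hg'.2 (fun a => congrArg (fun k => onE k a) s.condition)
          fun c _ hc => onE_eq_none_of_not_survives hg' s.condition hc))
      (fun s m h₁ h₂ => by
        apply hom_ext
        · rintro (b | c)
          · exact congrArg (fun k => onV k b) h₁
          · refine Eq.trans ?_ (congrArg (fun k => onV k c.1) h₂)
            exact congrArg (fun o => o.bind (onV m)) (glueNode_of_notMem_range f g c.2.1).symm
        · rintro (b | c)
          · exact congrArg (fun k => onE k b) h₁
          · refine Eq.trans ?_ (congrArg (fun k => onE k c.1) h₂)
            exact congrArg (fun o => o.bind (onE m))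
              (amalgMap_of_pos (P := Survives f g) c.2.1 c.2.2).symm)

theorem exists_isPushout (f : A ⟶ B) (hg : Total g) (hg' : Inj g) :
    ∃ (D : HGraph.{v, u} ar) (i : B ⟶ D) (j : C ⟶ D), IsPushout f g i j :=
  ⟨_, _, _, isPushout_glue hg hg'⟩

variable {D : HGraph.{v, u} ar} {i : B ⟶ D} {j : C ⟶ D}

theorem exists_iso_glue (h : IsPushout f g i j) (hg : Total g) (hg' : Inj g) :
    ∃ t : glue f g ⟶ D, Total t ∧ Inj t ∧ Surj t ∧
      glueInl f g ≫ t = i ∧ glueInr f g hg' ≫ t = j := by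
  let t := (isPushout_glue (f := f) hg hg').isoIsPushout _ _ h
  exact ⟨t.hom, total_of_comp_eq_id t.hom_inv_id, inj_of_comp_eq_id t.hom_inv_id,
    surj_of_comp_eq_id t.inv_hom_id, by simp [t], by simp [t]⟩

theorem isAmalgam_onV (h : IsPushout f g i j) (hg : Total g) (hg' : Inj g) :
    IsAmalgam (onV g) (onV i) (onV j) := by
  obtain ⟨t, ht, ht', ht'', rfl, rfl⟩ := exists_iso_glue h hg hg'
  exact isAmalgam_amalgMap.bind ht.1 ht'.1 ht''.1

theorem isAmalgam_onE (h : IsPushout f g i j) (hg : Total g) (hg' : Inj g) :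
    IsAmalgam (onE g) (onE i) (onE j) := by
  obtain ⟨t, ht, ht', ht'', rfl, rfl⟩ := exists_iso_glue h hg hg'
  exact isAmalgam_amalgMap.bind ht.2 ht'.2 ht''.2

/-- Nodes outside the range of `g` are never lost, whereas edges may dangle. Minimality of pushout
complements is therefore a question about edges only. -/
theorem exists_onV_of_notMem_range (h : IsPushout f g i j) (hg : Total g) (hg' : Inj g) {c : C.V}
    (hc : ∀ a, onV g a ≠ some c) : ∃ d, onV j c = some d := by
  obtain ⟨t, ht, ht', ht'', rfl, rfl⟩ := exists_iso_glue h hg hg'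
  have : onV (glueInr f g hg') c = _ := glueNode_of_notMem_range f g hc
  rw [onV_comp, this]
  exact ht.1 _

theorem total_of_isPushout (h : IsPushout f g i j) (hg : Total g) (hg' : Inj g) : Total i :=
  ⟨(isAmalgam_onV h hg hg').total, (isAmalgam_onE h hg hg').total⟩

theorem inj_of_isPushout (h : IsPushout f g i j) (hg : Total g) (hg' : Inj g) : Inj i :=
  ⟨(isAmalgam_onV h hg hg').inj, (isAmalgam_onE h hg hg').inj⟩

end Glue

/-! ### Instantiation steps: exchange and the counting argument -/

section Steps

variable {ρ : UQRule.{v, u} ar}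

/-- The quantification `w` turns the instantiation data `ι` into `κ`. -/
structure StepData (ι : InstData ρ) (w : UQuant ρ.L) (κ : InstData ρ) where
  p' : ι.Lbar ⟶ κ.Lbar
  π' : w.Lu ⟶ κ.Lbar
  isPushout_left : IsPushout ι.π w.p p' π'
  i : ι.Rbar ⟶ κ.Rbar
  j : w.Ru ⟶ κ.Rbar
  isPushout_right : IsPushout (ι.π ≫ ι.γ) (w.p ≫ w.q) i j
  π_eq : κ.π = ι.π ≫ p'
  left_comp : p' ≫ κ.γ = ι.γ ≫ i
  right_comp : π' ≫ κ.γ = w.q ≫ j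

/-- In `StepData` the left morphism of `κ` is fixed only by an equation, so that a step can be
stated between two given data; here it is substituted to match the constructor. -/
theorem StepData.isInstantiation {k : ℕ} {ι κ : InstData ρ} {w : UQuant ρ.L}
    (s : StepData ι w κ) (hι : IsInstantiation ρ k ι) (hw : w ∈ ρ.U) :
    IsInstantiation ρ (k + 1) κ := by
  obtain ⟨L', R', π, γ⟩ := κ
  obtain ⟨p', π', hL, i, j, hR, hπ, h₁, h₂⟩ := s
  dsimp only at p' π' i j hL hR hπ h₁ h₂
  subst hπ
  exact IsInstantiation.step hι hw hL hR h₁ h₂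

theorem UQuant.total_comp {L : HGraph.{v, u} ar} (w : UQuant L) : Total (w.p ≫ w.q) :=
  ⟨fun x => (w.q_node x).imp fun _ h => h.1, fun x => (w.q_edge x).imp fun _ h => h.1⟩

/-- An element of `L` is the only preimage of its image, up to `p`. -/
theorem UQuant.onV_p_of_onV_q {L : HGraph.{v, u} ar} (w : UQuant L) {x : L.V} {y : w.Ru.V}
    {z : w.Lu.V} (hx : onV (w.p ≫ w.q) x = some y) (hz : onV w.q z = some y) :
    onV w.p x = some z := by
  obtain ⟨y', hy', hu⟩ := w.q_node x
  obtain rfl := Option.some.inj (hx.symm.trans hy')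
  obtain ⟨z', hz', hz''⟩ := onV_comp_eq_some.1 hx
  rw [hz', hu.unique hz hz'']

theorem UQuant.onE_p_of_onE_q {L : HGraph.{v, u} ar} (w : UQuant L) {x : L.E} {y : w.Ru.E}
    {z : w.Lu.E} (hx : onE (w.p ≫ w.q) x = some y) (hz : onE w.q z = some y) :
    onE w.p x = some z := by
  obtain ⟨y', hy', hu⟩ := w.q_edge x
  obtain rfl := Option.some.inj (hx.symm.trans hy')
  obtain ⟨z', hz', hz''⟩ := onE_comp_eq_some.1 hx
  rw [hz', hu.unique hz hz'']

/-- With `UQuant.total_comp`, this makes the right-hand square of a step a pushout along a total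
injection as well, although `q` itself is partial. -/
theorem UQuant.inj_comp {L : HGraph.{v, u} ar} (w : UQuant L) : Inj (w.p ≫ w.q) := by
  constructor
  · intro x x' y hx hx'
    obtain ⟨z, hz, hz'⟩ := onV_comp_eq_some.1 hx
    exact w.p_inj.1 _ _ _ hz (w.onV_p_of_onV_q hx' hz')
  · intro x x' y hx hx'
    obtain ⟨z, hz, hz'⟩ := onE_comp_eq_some.1 hx
    exact w.p_inj.2 _ _ _ hz (w.onE_p_of_onE_q hx' hz')

/-- Two consecutive steps may be exchanged. -/
theorem StepData.exchange {ι κ τ : InstData ρ} {w₁ w₂ : UQuant ρ.L} (s₁ : StepData ι w₁ κ)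
    (s₂ : StepData κ w₂ τ) :
    ∃ (κ' : InstData ρ) (_ : StepData ι w₂ κ') (t : StepData κ' w₁ τ), t.j = s₁.j ≫ s₂.i := by
  -- The intermediate data come from applying `w₂` directly to `ι`.
  obtain ⟨X, pX, πX, hX⟩ := exists_isPushout ι.π w₂.p_total w₂.p_inj
  obtain ⟨Y, iY, jY, hY⟩ := exists_isPushout (ι.π ≫ ι.γ) w₂.total_comp w₂.inj_comp
  have hη : ι.π ≫ ι.γ ≫ iY = w₂.p ≫ w₂.q ≫ jY := by simpa using hY.w
  have hη₁ := hX.inl_desc _ _ hη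
  have hη₂ := hX.inr_desc _ _ hη
  generalize hX.desc _ _ hη = η at hη₁ hη₂
  have hL := s₂.isPushout_left
  have hR := s₂.isPushout_right
  have hκ : κ.π ≫ κ.γ = (ι.π ≫ ι.γ) ≫ s₁.i := by
    rw [s₁.π_eq, Category.assoc, s₁.left_comp, Category.assoc]
  rw [s₁.π_eq] at hL
  rw [hκ] at hR
  have hp : ι.π ≫ s₁.p' ≫ s₂.p' = w₂.p ≫ s₂.π' := by simpa using hL.w
  have hp₁ := hX.inl_desc _ _ hp
  have hp₂ := hX.inr_desc _ _ hp
  generalize hX.desc _ _ hp = p'' at hp₁ hp₂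
  have hi : (ι.π ≫ ι.γ) ≫ s₁.i ≫ s₂.i = (w₂.p ≫ w₂.q) ≫ s₂.j := by simpa using hR.w
  have hi₁ := hY.inl_desc _ _ hi
  have hi₂ := hY.inr_desc _ _ hi
  generalize hY.desc _ _ hi = i'' at hi₁ hi₂
  -- The `w₂` square over `κ` factors through the `w₂` square over `ι`, so the remaining square is a
  -- pushout. Pasting it to the `w₁` square over `ι` gives the `w₁` step out of the new data.
  have hL' : IsPushout s₁.p' pX s₂.p' p'' :=
    (IsPushout.of_left (h₁₁ := ι.π) (v₁₁ := w₂.p) (h₂₁ := πX)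
      (by rw [hp₂]; exact hL) hp₁.symm hX)
  have hR' : IsPushout s₁.i iY s₂.i i'' :=
    (IsPushout.of_left (h₁₁ := ι.π ≫ ι.γ) (v₁₁ := w₂.p ≫ w₂.q) (h₂₁ := jY)
      (by rw [hi₂]; exact hR) hi₁.symm hY)
  refine ⟨⟨X, Y, ι.π ≫ pX, η⟩, ⟨pX, πX, hX, iY, jY, hY, rfl, hη₁, hη₂⟩,
    ⟨p'', s₁.π' ≫ s₂.p', ?_, i'', s₁.j ≫ s₂.i, ?_, ?_, ?_, ?_⟩, rfl⟩
  · exact (s₁.isPushout_left.flip.paste_vert hL').flip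
  · have : (ι.π ≫ pX) ≫ η = (ι.π ≫ ι.γ) ≫ iY := by rw [Category.assoc, hη₁, Category.assoc]
    exact this ▸ (s₁.isPushout_right.flip.paste_vert hR').flip
  · simp [s₂.π_eq, s₁.π_eq, hp₁]
  · apply hX.hom_ext
    · rw [reassoc_of% hp₁, s₂.left_comp, reassoc_of% s₁.left_comp, reassoc_of% hη₁, hi₁]
    · rw [reassoc_of% hp₂, s₂.right_comp, reassoc_of% hη₂, hi₂]
  · rw [Category.assoc, s₂.left_comp, reassoc_of% s₁.right_comp]

/-- The morphism `ν` is undefined on everything that the step adds to the right-hand side. -/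
def StepData.Vacant {ι κ : InstData ρ} {w : UQuant ρ.L} (s : StepData ι w κ)
    {G : HGraph.{v, u} ar} (ν : κ.Rbar ⟶ G) : Prop :=
  (∀ t, (∀ x, onV (w.p ≫ w.q) x ≠ some t) → onV (s.j ≫ ν) t = none) ∧
  (∀ t, (∀ x, onE (w.p ≫ w.q) x ≠ some t) → onE (s.j ≫ ν) t = none)

/-- The number of nodes and edges in the image of a morphism. -/
noncomputable def imageSize {A B : HGraph.{v, u} ar} (f : A ⟶ B) : ℕ :=
  {y | ∃ x, onV f x = some y}.ncard + {y | ∃ x, onE f x = some y}.ncard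

theorem imageSize_le_size {A B : HGraph.{v, u} ar} (f : A ⟶ B) : imageSize f ≤ B.size := by
  rw [imageSize, HGraph.size, ← Nat.card_eq_fintype_card, ← Nat.card_eq_fintype_card]
  exact add_le_add (Set.ncard_le_card _) (Set.ncard_le_card _)

theorem range_onV_comp_subset {A B C : HGraph.{v, u} ar} (f : A ⟶ B) (g : B ⟶ C) :
    {y | ∃ x, onV (f ≫ g) x = some y} ⊆ {y | ∃ x, onV g x = some y} := by
  rintro y ⟨x, hx⟩
  obtain ⟨z, -, hz⟩ := onV_comp_eq_some.1 hx
  exact ⟨z, hz⟩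

theorem range_onE_comp_subset {A B C : HGraph.{v, u} ar} (f : A ⟶ B) (g : B ⟶ C) :
    {y | ∃ x, onE (f ≫ g) x = some y} ⊆ {y | ∃ x, onE g x = some y} := by
  rintro y ⟨x, hx⟩
  obtain ⟨z, -, hz⟩ := onE_comp_eq_some.1 hx
  exact ⟨z, hz⟩

/-- A new element on which `ν` is defined has an image missed by `s.i ≫ ν`: by injectivity of `ν` it
would otherwise lie in the range of `s.i`, and `overlap` would make it old. -/
theorem StepData.imageSize_lt {ι κ : InstData ρ} {w : UQuant ρ.L} (s : StepData ι w κ)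
    {G : HGraph.{v, u} ar} {ν : κ.Rbar ⟶ G} (hν : Inj ν) (h : ¬ s.Vacant ν) :
    imageSize (s.i ≫ ν) < imageSize ν := by
  have hV := Set.ncard_le_ncard (range_onV_comp_subset s.i ν)
  have hE := Set.ncard_le_ncard (range_onE_comp_subset s.i ν)
  rw [Vacant, not_and_or] at h
  rcases h with h | h
  · push Not at h
    obtain ⟨t, ht, hn⟩ := h
    obtain ⟨y, hy⟩ := Option.ne_none_iff_exists'.1 hn
    refine add_lt_add_of_lt_of_le (Set.ncard_lt_ncard ⟨range_onV_comp_subset s.i ν, ?_⟩) hE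
    obtain ⟨z, hz, hzy⟩ := onV_comp_eq_some.1 hy
    intro hsub
    obtain ⟨x, hx⟩ := hsub ⟨z, hzy⟩
    obtain ⟨z', hz', hzy'⟩ := onV_comp_eq_some.1 hx
    obtain rfl := hν.1 _ _ _ hzy hzy'
    obtain ⟨a, ha⟩ :=
      (isAmalgam_onV s.isPushout_right w.total_comp w.inj_comp).overlap _ _ _ hz' hz
    exact ht a ha
  · push Not at h
    obtain ⟨t, ht, hn⟩ := h
    obtain ⟨y, hy⟩ := Option.ne_none_iff_exists'.1 hn
    refine add_lt_add_of_le_of_lt hV (Set.ncard_lt_ncard ⟨range_onE_comp_subset s.i ν, ?_⟩)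
    obtain ⟨z, hz, hzy⟩ := onE_comp_eq_some.1 hy
    intro hsub
    obtain ⟨x, hx⟩ := hsub ⟨z, hzy⟩
    obtain ⟨z', hz', hzy'⟩ := onE_comp_eq_some.1 hx
    obtain rfl := hν.2 _ _ _ hzy hzy'
    obtain ⟨a, ha⟩ :=
      (isAmalgam_onE s.isPushout_right w.total_comp w.inj_comp).overlap _ _ _ hz' hz
    exact ht a ha

/-- If an instantiation is longer than the image of its right-hand side under `ν` is large, then
it arises from a shorter one by a step on which `ν` is undefined. -/
theorem IsInstantiation.exists_vacant {k : ℕ} {κ : InstData ρ} (hκ : IsInstantiation ρ k κ)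
    {G : HGraph.{v, u} ar} (ν : κ.Rbar ⟶ G) (hν : Inj ν) :
    k ≤ imageSize ν ∨ ∃ (k' : ℕ) (ι : InstData ρ) (w : UQuant ρ.L) (s : StepData ι w κ),
      w ∈ ρ.U ∧ k = k' + 1 ∧ IsInstantiation ρ k' ι ∧ s.Vacant ν := by
  induction hκ with
  | base => exact Or.inl (Nat.zero_le _)
  | @step k ι hι w hw L' R' p' π' hL i j hR η h₁ h₂ ih =>
    let s : StepData ι w ⟨L', R', ι.π ≫ p', η⟩ := ⟨p', π', hL, i, j, hR, rfl, h₁, h₂⟩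
    by_cases hs : s.Vacant ν
    · exact Or.inr ⟨k, ι, w, s, hw, rfl, hι, hs⟩
    -- If the last step is not vacant, look for a vacant step of the earlier instantiation with `ν`
    -- restricted to its right-hand side.
    rcases ih (s.i ≫ ν) ((inj_of_isPushout hR w.total_comp w.inj_comp).comp hν) with
      h | ⟨k', ι', w', s', hw', rfl, hι', hs'⟩
    · exact Or.inl (h.trans_lt (s.imageSize_lt hν hs))
    · obtain ⟨κ', t, t', ht'⟩ := s'.exchange s
      refine Or.inr ⟨k' + 1, κ', w', t', hw', rfl, t.isInstantiation hι' hw, ?_⟩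
      -- The exchange sends what `s'` adds to the same elements as before, so vacancy for `s.i ≫ ν`
      -- is vacancy of the moved step for `ν`.
      rw [StepData.Vacant, ht', Category.assoc]
      exact hs'

end Steps

/-! ### Inverses of injective partial morphisms -/

section PartialInverse

open Classical in
/-- The inverse of an injective partial map. -/
noncomputable def partialInv {α β : Type u} (f : α → Option β) (y : β) : Option α :=
  if h : ∃ x, f x = some y then some h.choose else none

theorem partialInv_eq_some_iff {α β : Type u} {f : α → Option β}
    (hf : ∀ x x' y, f x = some y → f x' = some y → x = x') {x : α} {y : β} :
    partialInv f y = some x ↔ f x = some y := by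
  constructor
  · intro h
    by_cases h' : ∃ x, f x = some y
    · rw [partialInv, dif_pos h'] at h
      cases h
      exact h'.choose_spec
    · rw [partialInv, dif_neg h'] at h
      cases h
  · intro h
    have h' : ∃ x, f x = some y := ⟨x, h⟩
    rw [partialInv, dif_pos h', hf _ _ _ h'.choose_spec h]

variable {A B : HGraph.{v, u} ar} {f : A ⟶ B}

/-- The inverse of an injective morphism. -/
noncomputable def Inj.inv (hf : Inj f) : B ⟶ A :=
  HGraph.Hom.mk (partialInv (onV f)) (partialInv (onE f))
    (by
      intro e e' h
      exact (lab_map f ((partialInv_eq_some_iff hf.2).1 h)).symm)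
    (by
      intro e e' h
      have h₁ := congrArg (List.map fun o : Option B.V => o.bind (partialInv (onV f)))
        (conn_map f ((partialInv_eq_some_iff hf.2).1 h))
      simp only [List.map_map] at h₁
      refine Eq.trans h₁.symm (List.map_congr_left fun x hx => ?_)
      obtain ⟨y, -, hy⟩ :=
        exists_mem_conn_of_onE f ((partialInv_eq_some_iff hf.2).1 h) hx
      simp only [Function.comp_apply, hy, Option.bind_some]
      exact (partialInv_eq_some_iff hf.1).2 hy)

theorem Inj.onV_inv_eq_some (hf : Inj f) {x : A.V} {y : B.V} :
    onV hf.inv y = some x ↔ onV f x = some y :=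
  partialInv_eq_some_iff hf.1

theorem Inj.onE_inv_eq_some (hf : Inj f) {x : A.E} {y : B.E} :
    onE hf.inv y = some x ↔ onE f x = some y :=
  partialInv_eq_some_iff hf.2

theorem Inj.inj_inv (hf : Inj f) : Inj hf.inv := by
  constructor
  · intro y y' x h h'
    rw [hf.onV_inv_eq_some] at h h'
    exact Option.some.inj (h.symm.trans h')
  · intro y y' x h h'
    rw [hf.onE_inv_eq_some] at h h'
    exact Option.some.inj (h.symm.trans h')

theorem Inj.surj_inv (hf : Inj f) (hf' : Total f) : Surj hf.inv :=
  ⟨fun x => (hf'.1 x).imp fun _ h => hf.onV_inv_eq_some.2 h,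
    fun x => (hf'.2 x).imp fun _ h => hf.onE_inv_eq_some.2 h⟩

theorem Inj.comp_inv (hf : Inj f) (hf' : Total f) : f ≫ hf.inv = 𝟙 A := by
  apply hom_ext
  · intro x
    obtain ⟨y, hy⟩ := hf'.1 x
    rw [onV_comp, hy, Option.bind_some, onV_id, hf.onV_inv_eq_some]
    exact hy
  · intro x
    obtain ⟨y, hy⟩ := hf'.2 x
    rw [onE_comp, hy, Option.bind_some, onE_id, hf.onE_inv_eq_some]
    exact hy

end PartialInverse

/-! ### Cardinality and the subgraph order -/

section Card

/-- Choosing preimages gives an injection from `β` into a set that is no larger, hence a bijection,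
so every `x` is a chosen preimage. -/
theorem exists_eq_some_of_card_le {α β : Type u} [Fintype α] [Fintype β] {f : α → Option β}
    (hf : ∀ y, ∃ x, f x = some y) (hc : Fintype.card α ≤ Fintype.card β) (x : α) :
    ∃ y, f x = some y := by
  choose h hh using hf
  have h_inj : Function.Injective h := fun y y' e => by
    have := hh y
    rw [e, hh y'] at this
    exact (Option.some.inj this).symm
  have h_bij : Function.Bijective h := (Fintype.bijective_iff_injective_and_card h).2
    ⟨h_inj, le_antisymm (Fintype.card_le_of_injective h h_inj) hc⟩
  obtain ⟨y, rfl⟩ := h_bij.2 x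
  exact ⟨y, hh y⟩

theorem card_le_of_surj {α β : Type u} [Fintype α] [Fintype β] {f : α → Option β}
    (hf : ∀ y, ∃ x, f x = some y) : Fintype.card β ≤ Fintype.card α := by
  choose h hh using hf
  refine Fintype.card_le_of_injective h fun y y' e => ?_
  have := hh y
  rw [e, hh y'] at this
  exact (Option.some.inj this).symm

/-- The cardinality bounds make the subgraph morphism total, so its inverse is a subgraph morphism
too. -/
theorem IsSubgraph.symm_of_card_le {A B : HGraph.{v, u} ar} (h : IsSubgraph A B)
    (hV : Fintype.card B.V ≤ Fintype.card A.V) (hE : Fintype.card B.E ≤ Fintype.card A.E) :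
    IsSubgraph B A := by
  obtain ⟨f, hf, hf'⟩ := h
  exact ⟨hf.inv, hf.inj_inv, hf.surj_inv
    ⟨exists_eq_some_of_card_le hf'.1 hV, exists_eq_some_of_card_le hf'.2 hE⟩⟩

/-- Among the amalgams with the same `f` and `i`, those with `j` defined outside the range of `g`
have the smallest `C`. -/
theorem IsAmalgam.card_le {A B C C₀ D : Type u} [Fintype C] [Fintype C₀] {f : A → Option B}
    {g : A → Option C} {g₀ : A → Option C₀} {i : B → Option D} {j : C → Option D}
    {j₀ : C₀ → Option D} (h : IsAmalgam g i j) (h₀ : IsAmalgam g₀ i j₀)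
    (comm₀ : ∀ a, (f a).bind i = (g₀ a).bind j₀) (g₀_total : ∀ a, ∃ c, g₀ a = some c)
    (g₀_inj : ∀ a a' c, g₀ a = some c → g₀ a' = some c → a = a')
    (hj : ∀ c, (∀ a, g a ≠ some c) → ∃ d, j c = some d) :
    Fintype.card C ≤ Fintype.card C₀ := by
  -- Map `C` to `C₀` through `A` on the range of `g`, and through a common image in `D` outside it.
  -- Elements of `D` of the second kind avoid the range of `i`, so they are reached by `j₀` from
  -- outside the range of `g₀`.
  have key : ∀ c, ∃ c₀, (∃ a, g a = some c ∧ g₀ a = some c₀) ∨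
      ((∀ a, g a ≠ some c) ∧ (∀ a, g₀ a ≠ some c₀) ∧ ∃ d, j c = some d ∧ j₀ c₀ = some d) := by
    intro c
    by_cases hc : ∃ a, g a = some c
    · obtain ⟨a, ha⟩ := hc
      obtain ⟨c₀, hc₀⟩ := g₀_total a
      exact ⟨c₀, Or.inl ⟨a, ha, hc₀⟩⟩
    · push Not at hc
      obtain ⟨d, hd⟩ := hj c hc
      have hi : ∀ b, i b ≠ some d := fun b hb => by
        obtain ⟨a, ha⟩ := h.overlap _ _ _ hb hd
        exact hc a ha
      obtain ⟨c₀, hc₀⟩ := (h₀.surj d).resolve_left fun ⟨b, hb⟩ => hi b hb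
      refine ⟨c₀, Or.inr ⟨hc, fun a ha => ?_, d, hd, hc₀⟩⟩
      have := comm₀ a
      rw [ha, Option.bind_some, hc₀] at this
      obtain ⟨b, -, hb⟩ := Option.bind_eq_some_iff.1 this
      exact hi b hb
  choose t ht using key
  refine Fintype.card_le_of_injective t fun c c' e => ?_
  have hc := ht c
  have hc' := ht c'
  rw [← e] at hc'
  rcases hc with ⟨a, ha, ha₀⟩ | ⟨hn, hn₀, d, hd, hd₀⟩ <;>
    rcases hc' with ⟨a', ha', ha₀'⟩ | ⟨hn', hn₀', d', hd', hd₀'⟩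
  · obtain rfl := g₀_inj _ _ _ ha₀ ha₀'
    exact Option.some.inj (ha.symm.trans ha')
  · exact (hn₀' a ha₀).elim
  · exact (hn₀ a' ha₀').elim
  · obtain rfl := Option.some.inj (hd₀.symm.trans hd₀')
    exact h.inj_compl _ _ _ hn hn' hd hd'

end Card

/-! ### Minimal pushout complements are those without dangling edges -/

section RestrictEdges

variable (H : HGraph.{v, u} ar) (P : H.E → Prop)

open Classical in
/-- The graph obtained by keeping all nodes and the edges that satisfy `P`. -/
noncomputable def restrictEdges : HGraph.{v, u} ar where
  V := H.V
  E := {e : H.E // P e}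
  conn e := H.conn e.1
  lab e := H.lab e.1
  length_conn e := H.length_conn e.1

/-- The inclusion of a graph with fewer edges. -/
noncomputable def restrictIncl : restrictEdges H P ⟶ H :=
  HGraph.Hom.mk some (fun e => some e.1) (by rintro e _ ⟨⟩; rfl) (by rintro e _ ⟨⟩; rfl)

theorem inj_restrictIncl : Inj (restrictIncl H P) :=
  ⟨fun _ _ _ h h' => Option.some.inj (h.trans h'.symm),
    fun _ _ _ h h' => Subtype.ext (Option.some.inj (h.trans h'.symm))⟩

theorem total_restrictIncl : Total (restrictIncl H P) :=
  ⟨fun x => ⟨x, rfl⟩, fun x => ⟨x.1, rfl⟩⟩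

end RestrictEdges

section MinComplement

variable {L R G H : HGraph.{v, u} ar} {φ : L ⟶ R} {m' : R ⟶ G} {m : L ⟶ H} {φ' : H ⟶ G}

/-- A minimal pushout complement has no dangling edges. -/
theorem IsMinComplement.exists_onE (hmin : IsMinComplement φ m' H m) (h : IsPushout φ m m' φ')
    {e : H.E} (he : ∀ a, onE m a ≠ some e) : ∃ d, onE φ' e = some d := by
  obtain ⟨⟨m_total, m_inj, -⟩, hmin⟩ := hmin
  -- The discarded edges lie outside the match and have no image in `G`. Removing them should leave
  -- a pushout complement, so minimality must forbid them.
  let P : H.E → Prop := fun e => (∃ a, onE m a = some e) ∨ ∃ d, onE φ' e = some d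
  let inc := restrictIncl H P
  have inc_inj : Inj inc := inj_restrictIncl H P
  have inc_total : Total inc := total_restrictIncl H P
  let pr := inc_inj.inv
  have pr_surj : Surj pr := inc_inj.surj_inv inc_total
  have hprV : ∀ x : H.V, onV pr x = some x := fun x => inc_inj.onV_inv_eq_some.2 rfl
  have hprE : ∀ (e : H.E) (h : P e), onE pr e = some ⟨e, h⟩ :=
    fun e h => inc_inj.onE_inv_eq_some.2 rfl
  have hφ : pr ≫ inc ≫ φ' = φ' := by
    apply hom_ext
    · intro x
      rw [onV_comp, hprV]
      rfl
    · intro x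
      by_cases hx : P x
      · rw [onE_comp, hprE x hx]
        rfl
      · rw [onE_comp]
        have h₁ : onE pr x = none := by
          by_contra hn
          obtain ⟨y, hy⟩ := Option.ne_none_iff_exists'.1 hn
          have := inc_inj.onE_inv_eq_some.1 hy
          cases this
          exact hx y.2
        have h₂ : onE φ' x = none := by
          by_contra hn
          exact hx (Or.inr (Option.ne_none_iff_exists'.1 hn))
        rw [h₁, h₂]
        rfl
  have hcompl : IsComplement φ m' (restrictEdges H P) (m ≫ pr) := by
    refine ⟨⟨?_, ?_⟩, m_inj.comp inc_inj.inj_inv, inc ≫ φ', ?_⟩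
    · intro x
      obtain ⟨y, hy⟩ := m_total.1 x
      exact ⟨y, onV_comp_eq_some.2 ⟨y, hy, hprV y⟩⟩
    · intro x
      obtain ⟨y, hy⟩ := m_total.2 x
      exact ⟨⟨y, Or.inl ⟨x, hy⟩⟩, onE_comp_eq_some.2 ⟨y, hy, hprE y _⟩⟩
    · have w : φ ≫ m' = (m ≫ pr) ≫ inc ≫ φ' := by rw [Category.assoc, hφ, h.w]
      have := pr_surj.epi
      -- Composing with `pr` turns a cocone on the restricted graph into one on `H`; since `pr` is
      -- epi, the factorisation obtained there restricts back.
      refine IsPushout.of_isColimit' ⟨w⟩ (Limits.PushoutCocone.IsColimit.mk _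
        (fun s => h.desc s.inl (pr ≫ s.inr) (by rw [s.condition, Category.assoc]))
        (fun s => h.inl_desc _ _ _)
        (fun s => ?_) (fun s k h₁ h₂ => ?_))
      · rw [← cancel_epi pr, ← Category.assoc, hφ]
        exact h.inr_desc _ _ _
      · apply h.hom_ext
        · rw [h₁, h.inl_desc]
        · rw [h.inr_desc, ← h₂, ← Category.assoc pr, hφ]
  -- Minimality yields a surjection back onto `H`, so the edge counts agree and `pr` discards
  -- nothing.
  obtain ⟨σ, -, hσ⟩ := hmin _ _ hcompl ⟨pr, inc_inj.inj_inv, pr_surj⟩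
  have := exists_eq_some_of_card_le pr_surj.2 (card_le_of_surj hσ.2) e
  obtain ⟨y, hy⟩ := this
  have := inc_inj.onE_inv_eq_some.1 hy
  cases this
  exact y.2.resolve_left fun ⟨a, ha⟩ => he a ha

/-- A pushout complement without dangling edges is minimal. -/
theorem isMinComplement_of_exists_onE (hm : Total m) (hm' : Inj m) (h : IsPushout φ m m' φ')
    (he : ∀ e, (∀ a, onE m a ≠ some e) → ∃ d, onE φ' e = some d) :
    IsMinComplement φ m' H m := by
  refine ⟨⟨hm, hm', φ', h⟩, ?_⟩
  rintro H₀ m₀ ⟨hm₀, hm₀', φ₀, h₀⟩ hsub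
  -- Every competing complement has at least as many nodes and edges as `H`, so a competitor below
  -- `H` is also above it.
  refine hsub.symm_of_card_le ?_ ?_
  · exact (isAmalgam_onV h hm hm').card_le (isAmalgam_onV h₀ hm₀ hm₀')
      (fun a => congrArg (fun k => onV k a) h₀.w) hm₀.1 hm₀'.1
      fun c hc => exists_onV_of_notMem_range h hm hm' hc
  · exact (isAmalgam_onE h hm hm').card_le (isAmalgam_onE h₀ hm₀ hm₀')
      (fun a => congrArg (fun k => onE k a) h₀.w) hm₀.2 hm₀'.2 he

end MinComplement

/-! ### Stability of path bounds and of subgraph morphisms -/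

/-- A path of the subgraph lifts through chosen preimages. These stay distinct, and injectivity on
nodes makes the chosen node the one incident to the chosen edge. -/
theorem PathBounded.of_isSubgraph {b : ℕ∞} {A B : HGraph.{v, u} ar} (hB : PathBounded b B)
    (h : IsSubgraph A B) : PathBounded b A := by
  obtain ⟨f, hf, hf'⟩ := h
  rintro n vs es ⟨hvs, hes, hinc⟩
  choose s hs using hf'.1
  choose t ht using hf'.2
  have hs_inj : Function.Injective s := fun y y' e => by
    have := hs y
    rw [e, hs y'] at this
    exact (Option.some.inj this).symm
  have ht_inj : Function.Injective t := fun y y' e => by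
    have := ht y
    rw [e, ht y'] at this
    exact (Option.some.inj this).symm
  have hmem : ∀ x e, x ∈ A.conn e → s x ∈ B.conn (t e) := fun x e hx => by
    obtain ⟨y, hy, hyx⟩ := exists_mem_conn_lift f (ht e) hx
    rwa [hf.1 _ _ _ (hs x) hyx]
  exact hB n (s ∘ vs) (t ∘ es) ⟨hs_inj.comp hvs, ht_inj.comp hes,
    fun i => ⟨hmem _ _ (hinc i).1, hmem _ _ (hinc i).2⟩⟩

section PushoutSubgraph

variable {A B C D : HGraph.{v, u} ar} {f : A ⟶ B} {g : A ⟶ C} {i : B ⟶ D} {j : C ⟶ D}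

/-- Subgraph morphisms are stable under pushout along total injective morphisms. -/
theorem IsSubgraphMor.of_isPushout (hf : IsSubgraphMor f) (h : IsPushout f g i j) (hg : Total g)
    (hg' : Inj g) : IsSubgraphMor j := by
  have hV := isAmalgam_onV h hg hg'
  have hE := isAmalgam_onE h hg hg'
  have wV : ∀ a c d, onV g a = some c → onV j c = some d →
      ∃ b, onV f a = some b ∧ onV i b = some d := fun a c d hc hd => by
    rw [← onV_comp_eq_some, h.w]
    exact onV_comp_eq_some.2 ⟨c, hc, hd⟩
  have wE : ∀ a c d, onE g a = some c → onE j c = some d →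
      ∃ b, onE f a = some b ∧ onE i b = some d := fun a c d hc hd => by
    rw [← onE_comp_eq_some, h.w]
    exact onE_comp_eq_some.2 ⟨c, hc, hd⟩
  refine ⟨⟨?_, ?_⟩, ?_, ?_⟩
  · intro c c' d hc hc'
    -- Two elements with a common image are both in the range of `g` or both outside it, by
    -- `overlap`. The first case reduces to injectivity of `f` and `i`, the second is `inj_compl`.
    by_cases h₁ : ∃ a, onV g a = some c
    · obtain ⟨a, ha⟩ := h₁
      obtain ⟨b, hb, hd⟩ := wV _ _ _ ha hc
      obtain ⟨a', ha'⟩ := hV.overlap _ _ _ hd hc'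
      obtain ⟨b', hb', hd'⟩ := wV _ _ _ ha' hc'
      obtain rfl := hV.inj _ _ _ hd hd'
      obtain rfl := hf.1.1 _ _ _ hb hb'
      exact Option.some.inj (ha.symm.trans ha')
    · have h₂ : ¬ ∃ a', onV g a' = some c' := fun ⟨a', ha'⟩ => by
        obtain ⟨b', hb', hd'⟩ := wV _ _ _ ha' hc'
        exact h₁ (hV.overlap _ _ _ hd' hc)
      push Not at h₁ h₂
      exact hV.inj_compl _ _ _ h₁ h₂ hc hc'
  · intro c c' d hc hc'
    by_cases h₁ : ∃ a, onE g a = some c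
    · obtain ⟨a, ha⟩ := h₁
      obtain ⟨b, hb, hd⟩ := wE _ _ _ ha hc
      obtain ⟨a', ha'⟩ := hE.overlap _ _ _ hd hc'
      obtain ⟨b', hb', hd'⟩ := wE _ _ _ ha' hc'
      obtain rfl := hE.inj _ _ _ hd hd'
      obtain rfl := hf.1.2 _ _ _ hb hb'
      exact Option.some.inj (ha.symm.trans ha')
    · have h₂ : ¬ ∃ a', onE g a' = some c' := fun ⟨a', ha'⟩ => by
        obtain ⟨b', hb', hd'⟩ := wE _ _ _ ha' hc'
        exact h₁ (hE.overlap _ _ _ hd' hc)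
      push Not at h₁ h₂
      exact hE.inj_compl _ _ _ h₁ h₂ hc hc'
  · intro d
    rcases hV.surj d with ⟨b, hb⟩ | hc
    · obtain ⟨a, ha⟩ := hf.2.1 b
      have : onV (f ≫ i) a = some d := onV_comp_eq_some.2 ⟨b, ha, hb⟩
      rw [h.w] at this
      obtain ⟨c, -, hc⟩ := onV_comp_eq_some.1 this
      exact ⟨c, hc⟩
    · exact hc
  · intro d
    rcases hE.surj d with ⟨b, hb⟩ | hc
    · obtain ⟨a, ha⟩ := hf.2.2 b
      have : onE (f ≫ i) a = some d := onE_comp_eq_some.2 ⟨b, ha, hb⟩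
      rw [h.w] at this
      obtain ⟨c, -, hc⟩ := onE_comp_eq_some.1 this
      exact ⟨c, hc⟩
    · exact hc

end PushoutSubgraph

/-! ### Omitting a vacant step -/

namespace StepData

variable {ρ : UQRule.{v, u} ar} {ι κ : InstData ρ} {w : UQuant ρ.L} (s : StepData ι w κ)

/-- A step is undone by deleting what it adds to the left-hand side. -/
theorem exists_retraction : ∃ d : κ.Lbar ⟶ ι.Lbar, s.p' ≫ d = 𝟙 _ ∧
    s.π' ≫ d = w.p_inj.inv ≫ ι.π := by
  have h : ι.π ≫ 𝟙 _ = w.p ≫ w.p_inj.inv ≫ ι.π := by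
    rw [← Category.assoc, w.p_inj.comp_inv w.p_total, Category.comp_id, Category.id_comp]
  exact ⟨s.isPushout_left.desc _ _ h, s.isPushout_left.inl_desc _ _ h,
    s.isPushout_left.inr_desc _ _ h⟩

variable {s} in
-- The retraction is defined only on the range of `s.p'`: an element coming from `w.Lu` on which it
-- is defined already comes from `L`. There it is inverse to `s.p'`, hence injective.
theorem isSubgraphMor_retraction {d : κ.Lbar ⟶ ι.Lbar} (h₁ : s.p' ≫ d = 𝟙 _)
    (h₂ : s.π' ≫ d = w.p_inj.inv ≫ ι.π) : IsSubgraphMor d := by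
  have w₀ := s.isPushout_left.w
  refine ⟨⟨?_, ?_⟩, surj_of_comp_eq_id h₁⟩
  · have key : ∀ y x, onV d y = some x → onV s.p' x = some y := by
      intro y x hy
      rcases (isAmalgam_onV s.isPushout_left w.p_total w.p_inj).surj y with ⟨x', hx'⟩ | ⟨z, hz⟩
      · have h₃ : onV (s.p' ≫ d) x' = some x := onV_comp_eq_some.2 ⟨y, hx', hy⟩
        rw [h₁] at h₃
        cases h₃
        exact hx'
      · have h₃ : onV (s.π' ≫ d) z = some x := onV_comp_eq_some.2 ⟨y, hz, hy⟩
        rw [h₂] at h₃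
        obtain ⟨a, ha, hax⟩ := onV_comp_eq_some.1 h₃
        rw [w.p_inj.onV_inv_eq_some] at ha
        have h₄ : onV (w.p ≫ s.π') a = some y := onV_comp_eq_some.2 ⟨z, ha, hz⟩
        rw [← w₀] at h₄
        obtain ⟨x', hx', h₅⟩ := onV_comp_eq_some.1 h₄
        rwa [Option.some.inj (hax.symm.trans hx')]
    intro y y' x hy hy'
    exact Option.some.inj ((key _ _ hy).symm.trans (key _ _ hy'))
  · have key : ∀ y x, onE d y = some x → onE s.p' x = some y := by
      intro y x hy
      rcases (isAmalgam_onE s.isPushout_left w.p_total w.p_inj).surj y with ⟨x', hx'⟩ | ⟨z, hz⟩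
      · have h₃ : onE (s.p' ≫ d) x' = some x := onE_comp_eq_some.2 ⟨y, hx', hy⟩
        rw [h₁] at h₃
        cases h₃
        exact hx'
      · have h₃ : onE (s.π' ≫ d) z = some x := onE_comp_eq_some.2 ⟨y, hz, hy⟩
        rw [h₂] at h₃
        obtain ⟨a, ha, hax⟩ := onE_comp_eq_some.1 h₃
        rw [w.p_inj.onE_inv_eq_some] at ha
        have h₄ : onE (w.p ≫ s.π') a = some y := onE_comp_eq_some.2 ⟨z, ha, hz⟩
        rw [← w₀] at h₄
        obtain ⟨x', hx', h₅⟩ := onE_comp_eq_some.1 h₄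
        rwa [Option.some.inj (hax.symm.trans hx')]
    intro y y' x hy hy'
    exact Option.some.inj ((key _ _ hy).symm.trans (key _ _ hy'))

variable {s} {R' : HGraph.{v, u} ar} {μ : κ.Rbar ⟶ R'}

/-- By the unique-preimage condition on `q`, an element outside the range of `w.p` is either
undefined under `w.q` or sent to a new element of `w.Ru`, where vacancy makes the rest undefined. -/
theorem Vacant.inv_comp (hs : s.Vacant μ) :
    w.p_inj.inv ≫ w.p ≫ w.q ≫ s.j ≫ μ = w.q ≫ s.j ≫ μ := by
  apply hom_ext
  · intro z
    by_cases hz : ∃ x, onV w.p x = some z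
    · obtain ⟨x, hx⟩ := hz
      rw [onV_comp, w.p_inj.onV_inv_eq_some.2 hx, Option.bind_some, onV_comp, hx, Option.bind_some]
    · have h₁ : onV w.p_inj.inv z = none := by
        by_contra hn
        obtain ⟨x, hx⟩ := Option.ne_none_iff_exists'.1 hn
        exact hz ⟨x, w.p_inj.onV_inv_eq_some.1 hx⟩
      rw [onV_comp, h₁, onV_comp]
      cases hq : onV w.q z with
      | none => rfl
      | some t => exact (hs.1 t fun x hx => hz ⟨x, w.onV_p_of_onV_q hx hq⟩).symm
  · intro z
    by_cases hz : ∃ x, onE w.p x = some z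
    · obtain ⟨x, hx⟩ := hz
      rw [onE_comp, w.p_inj.onE_inv_eq_some.2 hx, Option.bind_some, onE_comp, hx, Option.bind_some]
    · have h₁ : onE w.p_inj.inv z = none := by
        by_contra hn
        obtain ⟨x, hx⟩ := Option.ne_none_iff_exists'.1 hn
        exact hz ⟨x, w.p_inj.onE_inv_eq_some.1 hx⟩
      rw [onE_comp, h₁, onE_comp]
      cases hq : onE w.q z with
      | none => rfl
      | some t => exact (hs.2 t fun x hx => hz ⟨x, w.onE_p_of_onE_q hx hq⟩).symm

/-- The identity that lets the same `R'` and co-match serve both instantiations. It is checked on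
the two legs of the left-hand pushout, and vacancy is needed only on the leg from `w.Lu`. -/
theorem Vacant.retraction_comp (hs : s.Vacant μ) {d : κ.Lbar ⟶ ι.Lbar} (h₁ : s.p' ≫ d = 𝟙 _)
    (h₂ : s.π' ≫ d = w.p_inj.inv ≫ ι.π) : d ≫ ι.γ ≫ s.i ≫ μ = κ.γ ≫ μ := by
  have hw : ι.π ≫ ι.γ ≫ s.i ≫ μ = w.p ≫ w.q ≫ s.j ≫ μ := by
    have := congrArg (fun k => k ≫ μ) s.isPushout_right.w
    simpa using this
  apply s.isPushout_left.hom_ext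
  · rw [reassoc_of% h₁, reassoc_of% s.left_comp]
  · rw [reassoc_of% h₂, reassoc_of% s.right_comp, hw, hs.inv_comp]

/-- Surjectivity survives because the right-hand side outside the range of `s.i` consists of new
elements, on which `μ` is undefined. -/
theorem Vacant.isSubgraphMor (hs : s.Vacant μ) (hμ : IsSubgraphMor μ) :
    IsSubgraphMor (s.i ≫ μ) := by
  have hR := s.isPushout_right
  refine ⟨(inj_of_isPushout hR w.total_comp w.inj_comp).comp hμ.1, ?_, ?_⟩
  · intro y
    obtain ⟨z, hz⟩ := hμ.2.1 y
    rcases (isAmalgam_onV hR w.total_comp w.inj_comp).surj z with ⟨x, hx⟩ | ⟨t, ht⟩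
    · exact ⟨x, onV_comp_eq_some.2 ⟨z, hx, hz⟩⟩
    · by_cases h : ∃ a, onV (w.p ≫ w.q) a = some t
      · obtain ⟨a, ha⟩ := h
        have h₁ : onV ((w.p ≫ w.q) ≫ s.j) a = some z := onV_comp_eq_some.2 ⟨t, ha, ht⟩
        rw [← hR.w] at h₁
        obtain ⟨x, -, hx⟩ := onV_comp_eq_some.1 h₁
        exact ⟨x, onV_comp_eq_some.2 ⟨z, hx, hz⟩⟩
      · push Not at h
        have h₁ := hs.1 t h
        rw [onV_comp, ht, Option.bind_some, hz] at h₁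
        cases h₁
  · intro y
    obtain ⟨z, hz⟩ := hμ.2.2 y
    rcases (isAmalgam_onE hR w.total_comp w.inj_comp).surj z with ⟨x, hx⟩ | ⟨t, ht⟩
    · exact ⟨x, onE_comp_eq_some.2 ⟨z, hx, hz⟩⟩
    · by_cases h : ∃ a, onE (w.p ≫ w.q) a = some t
      · obtain ⟨a, ha⟩ := h
        have h₁ : onE ((w.p ≫ w.q) ≫ s.j) a = some z := onE_comp_eq_some.2 ⟨t, ha, ht⟩
        rw [← hR.w] at h₁
        obtain ⟨x, -, hx⟩ := onE_comp_eq_some.1 h₁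
        exact ⟨x, onE_comp_eq_some.2 ⟨z, hx, hz⟩⟩
      · push Not at h
        have h₁ := hs.2 t h
        rw [onE_comp, ht, Option.bind_some, hz] at h₁
        cases h₁

/-- Vacancy is found by counting in `G`, but the omission argument needs it in `R'`. -/
theorem Vacant.of_comp {G : HGraph.{v, u} ar} {m' : R' ⟶ G} (hs : s.Vacant (μ ≫ m'))
    (hm' : Total m') : s.Vacant μ := by
  constructor
  · intro t ht
    by_contra hn
    obtain ⟨y, hy⟩ := Option.ne_none_iff_exists'.1 hn
    obtain ⟨z, hz⟩ := hm'.1 y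
    have h₁ := hs.1 t ht
    rw [← Category.assoc, onV_comp_eq_some.2 ⟨y, hy, hz⟩] at h₁
    cases h₁
  · intro t ht
    by_contra hn
    obtain ⟨y, hy⟩ := Option.ne_none_iff_exists'.1 hn
    obtain ⟨z, hz⟩ := hm'.2 y
    have h₁ := hs.2 t ht
    rw [← Category.assoc, onE_comp_eq_some.2 ⟨y, hy, hz⟩] at h₁
    cases h₁

/-- An edge at a quantified node of `H'` lifts along `e` to an edge at the corresponding node of
`H`. That edge is matched there, and commutativity brings its preimage down to `ι.Lbar`. -/
theorem appCondition_of_comm {d : κ.Lbar ⟶ ι.Lbar} (h₁ : s.p' ≫ d = 𝟙 _)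
    {H H' : HGraph.{v, u} ar} {m : κ.Lbar ⟶ H} {m₁ : ι.Lbar ⟶ H'} {e : H ⟶ H'}
    (h : d ≫ m₁ = m ≫ e) (he : IsSubgraphMor e) (hκ : AppCondition κ m) :
    AppCondition ι m₁ := by
  have hm₁ : m₁ = s.p' ≫ m ≫ e := by rw [← h, reassoc_of% h₁]
  intro x hx y' hy' c' hc'
  have h₂ : ι.π ≫ m₁ = (κ.π ≫ m) ≫ e := by simp [hm₁, s.π_eq]
  rw [h₂] at hy'
  obtain ⟨y, hy, hyy'⟩ := onV_comp_eq_some.1 hy'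
  obtain ⟨c, hc⟩ := he.2.2 c'
  obtain ⟨y₂, hy₂, hyy₂⟩ := exists_mem_conn_lift e hc hc'
  obtain rfl := he.1.1 _ _ _ hyy' hyy₂
  obtain ⟨c₀, hc₀⟩ := hκ x hx y hy c hy₂
  have h₃ : onE (m ≫ e) c₀ = some c' := onE_comp_eq_some.2 ⟨c, hc₀, hc⟩
  rw [← h] at h₃
  obtain ⟨a, -, ha⟩ := onE_comp_eq_some.1 h₃
  exact ⟨a, ha⟩

/-- A step on which `μ` is undefined can be omitted in a backward application. -/
theorem Vacant.exists_backward {b : ℕ∞} {G H : HGraph.{v, u} ar} {m' : R' ⟶ G} {m : κ.Lbar ⟶ H}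
    (hs : s.Vacant μ) (hμ : IsSubgraphMor μ) (hm' : Total m') (hm'' : Inj m')
    (hmin : IsMinComplement (κ.γ ≫ μ) m' H m) (happ : AppCondition κ m)
    (hb : PathBounded b H) : ∃ H' ∈ backward b ι G, IsSubgraph H' H := by
  obtain ⟨d, h₁, h₂⟩ := s.exists_retraction
  obtain ⟨m_total, m_inj, φ', hφ'⟩ := hmin.1
  -- `H'` is what remains of `H` when the deletion `d` is carried out at the match.
  obtain ⟨H', m₁, e, hH'⟩ := exists_isPushout d m_total m_inj
  have he := (isSubgraphMor_retraction h₁ h₂).of_isPushout hH' m_total m_inj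
  have hd := hs.retraction_comp h₁ h₂
  have hw : d ≫ (ι.γ ≫ s.i ≫ μ) ≫ m' = m ≫ φ' := by
    rw [← hφ'.w, ← hd]
    simp
  have hψ₁ := hH'.inl_desc _ _ hw
  have hψ₂ := hH'.inr_desc _ _ hw
  generalize hH'.desc _ _ hw = ψ at hψ₁ hψ₂
  -- Since `d` followed by the shorter rule morphism is the longer one, the given pushout square
  -- decomposes along `hH'`.
  have hpo : IsPushout (ι.γ ≫ s.i ≫ μ) m₁ m' ψ :=
    IsPushout.of_left (by rw [hd, hψ₂]; exact hφ') hψ₁.symm hH'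
  refine ⟨H', ⟨R', s.i ≫ μ, m', m₁, hs.isSubgraphMor hμ, hm', hm'', ?_,
    appCondition_of_comm h₁ hH'.w he happ, hb.of_isSubgraph ⟨e, he⟩⟩, e, he⟩
  refine isMinComplement_of_exists_onE (total_of_isPushout hH' m_total m_inj)
    (inj_of_isPushout hH' m_total m_inj) hpo fun c' hc' => ?_
  -- An unmatched edge of `H'` lifts to an unmatched edge of `H`, which has an image in `G` by
  -- minimality of `H`; this image is also that of the original edge under `ψ`.
  obtain ⟨c, hc⟩ := he.2.2 c'
  have hcm : ∀ a, onE m a ≠ some c := fun a ha => by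
    have h₃ : onE (m ≫ e) a = some c' := onE_comp_eq_some.2 ⟨c, ha, hc⟩
    rw [← hH'.w] at h₃
    obtain ⟨x, -, hx⟩ := onE_comp_eq_some.1 h₃
    exact hc' x hx
  obtain ⟨g, hg⟩ := hmin.exists_onE hφ' hcm
  rw [← hψ₂, onE_comp, hc, Option.bind_some] at hg
  exact ⟨g, hg⟩

end StepData

/-! ### Shortening instantiations and the length bound -/

variable {ρ : UQRule.{v, u} ar} {b : ℕ∞} {G : HGraph.{v, u} ar}

theorem IsInstantiation.exists_shorter {k : ℕ} {κ : InstData ρ} (hκ : IsInstantiation ρ k κ)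
    (hk : G.size < k) {H : HGraph.{v, u} ar} (hH : H ∈ backward b κ G) :
    ∃ (k' : ℕ) (ι : InstData ρ), k' < k ∧ IsInstantiation ρ k' ι ∧
      ∃ H' ∈ backward b ι G, IsSubgraph H' H := by
  obtain ⟨R', μ, m', m, hμ, hm', hm'', hmin, happ, hb⟩ := hH
  rcases hκ.exists_vacant (μ ≫ m') (hμ.1.comp hm'') with h | ⟨k', ι, w, s, -, rfl, hι, hs⟩
  · exact absurd (h.trans (imageSize_le_size _)) (not_le.2 hk)
  · exact ⟨k', ι, Nat.lt_succ_self _, hι,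
      (hs.of_comp hm').exists_backward hμ hm' hm'' hmin happ hb⟩

/-- Shortening keeps `G`, and with it the threshold, fixed while the length drops, so it can be
repeated until the bound is met. -/
theorem IsInstantiation.exists_le_size {k : ℕ} {κ : InstData ρ} (hκ : IsInstantiation ρ k κ)
    {H : HGraph.{v, u} ar} (hH : H ∈ backward b κ G) :
    ∃ H' ∈ backwardUpTo G.size b ρ G, IsSubgraph H' H := by
  induction k using Nat.strong_induction_on generalizing κ H with
  | _ k ih =>
    by_cases hk : k ≤ G.size
    · exact ⟨H, ⟨k, κ, hk, hκ, hH⟩, 𝟙 H,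
        inj_of_comp_eq_id (Category.id_comp _), surj_of_comp_eq_id (Category.id_comp _)⟩
    · obtain ⟨k', ι, hk', hι, H₁, hH₁, hsub⟩ := hκ.exists_shorter (not_le.1 hk) hH
      obtain ⟨H₂, hH₂, hsub'⟩ := ih k' hk' hι hH₁
      exact ⟨H₂, hH₂, hsub'.trans hsub⟩

end UGTS

theorem mainTheorem2 {Λ : Type*} {ar : Λ → ℕ} (ρ : UGTS.UQRule ar) (b : ℕ∞)
    (G : UGTS.HGraph ar) :
    (∀ (k : ℕ) (ι : UGTS.InstData ρ), UGTS.IsInstantiation ρ k ι → G.size < k →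
      ∀ H ∈ UGTS.backward b ι G,
        ∃ (k' : ℕ) (ι' : UGTS.InstData ρ), k' < k ∧ UGTS.IsInstantiation ρ k' ι' ∧
          ∃ H' ∈ UGTS.backward b ι' G, UGTS.IsSubgraph H' H) ∧
    UGTS.upClosure (UGTS.backwardAll b ρ G) =
      UGTS.upClosure (UGTS.backwardUpTo G.size b ρ G) := by
  refine ⟨fun k ι hι hk H hH => hι.exists_shorter hk hH, Set.Subset.antisymm ?_ ?_⟩
  · rintro K ⟨H, ⟨k, ι, hι, hH⟩, hK⟩
    obtain ⟨H', hH', hsub⟩ := hι.exists_le_size hH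
    exact ⟨H', hH', hsub.trans hK⟩
  · rintro K ⟨H, ⟨k, ι, -, hι, hH⟩, hK⟩
    exact ⟨H, ⟨k, ι, hι, hH⟩, hK⟩
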